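/- Let $n\ge 1$ and let $T\colon\mathbb{R}^n\times X\to X$ be a continuous action of $\mathbb{R}^n$ on a compact metrizable space $X$. For $x\in X$ let $\mathfrak{g}_x$ be the largest linear subspace $\mathfrak g\subset\mathbb{R}^n$ such that $T^t x=x$ for all $t\in\mathfrak g$, and put $X_k=\{x\in X\mid \dim\mathfrak{g}_x\ge k\}$ for $0\le k\le n$; thus $X_n$ is the set of fixed points of $T$. Let $I=[0,1]$ and let $Y=\mathrm{Lip}_1(\mathbb{R}^n,I)$ be the space of maps $\varphi\colon\mathbb{R}^n\to I$ with $|\varphi(t)-\varphi(u)|\le|t-u|$ for all $t,u\in\mathbb{R}^n$ (Euclidean norm), with the metric \[ \mathbf{d}(\varphi,\psi)=\sup_{m\ge 1}\Bigl(2^{-m}\sup_{|t|\le m}|\varphi(t)-\psi(t)|\Bigr) \] and the shift action $(\sigma^u\varphi)(t)=\varphi(t+u)$ of $\mathbb{R}^n$. For $0\le k\le n$ let $Y_k$ be the set of $\varphi\in Y$ for which there is a linear subspace $V\subset\mathbb{R}^n$ of dimension at least $k$ with $\varphi(t+u)=\varphi(t)$ for all $t\in\mathbb{R}^n$ and $u\in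 V$. Suppose that $\iota\colon X_n\to Y_n$ is a topological embedding, and let $\mathcal{C}$ be the space of continuous maps $f\colon X\to Y$ such that $f\circ T^t=\sigma^t\circ f$ for all $t\in\mathbb{R}^n$ and $f(x)=\iota(x)$ for all $x\in X_n$, with the metric $D(f,g)=\sup_{x\in X}\mathbf{d}(f(x),g(x))$. Let $0\le k\le n-1$ and $p\in X_k\setminus X_{k+1}$. Then there exists a closed neighbourhood $A$ of $p$ in $X_k$ with $A\cap X_{k+1}=\emptyset$ such that \[ \mathcal{C}_k(A)=\{f\in\mathcal{C}\mid f(A)\cap Y_{k+1}=\emptyset\} \] is open and dense in $\mathcal{C}$. -/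

import Mathlib

open Topology

namespace LipEmbedding

/-- `ℝⁿ` with its Euclidean norm. -/
abbrev Rn (n : ℕ) : Type := EuclideanSpace ℝ (Fin n)

/-- `Lip₁(ℝⁿ, I)`: the one-Lipschitz maps from `ℝⁿ` to `I = [0,1]`. -/
@[ext]
structure LipOne (n : ℕ) : Type where
  toFun : Rn n → unitInterval
  lipschitz : ∀ t u : Rn n, |(toFun t : ℝ) - (toFun u : ℝ)| ≤ ‖t - u‖

instance (n : ℕ) : CoeFun (LipOne n) (fun _ => Rn n → unitInterval) := ⟨LipOne.toFun⟩

/-- `sup_{|t| ≤ m} |φ(t) - ψ(t)|`. -/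
noncomputable def supOnBall {n : ℕ} (φ ψ : LipOne n) (m : ℕ+) : ℝ :=
  ⨆ t : Metric.closedBall (0 : Rn n) (m : ℝ), |(φ t : ℝ) - (ψ t : ℝ)|

/-- The metric `d(φ, ψ) = sup_{m ≥ 1} 2⁻ᵐ sup_{|t| ≤ m} |φ(t) - ψ(t)|`. -/
noncomputable def lipDist {n : ℕ} (φ ψ : LipOne n) : ℝ :=
  ⨆ m : ℕ+, ((2 : ℝ) ^ (m : ℕ))⁻¹ * supOnBall φ ψ m

theorem abs_sub_le_one {n : ℕ} (φ ψ : LipOne n) (t : Rn n) : |(φ t : ℝ) - (ψ t : ℝ)| ≤ 1 := by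
  have h1 := (φ t).2.1
  have h2 := (φ t).2.2
  have h3 := (ψ t).2.1
  have h4 := (ψ t).2.2
  rw [abs_le]
  constructor <;> linarith

theorem closedBall_nonempty {n : ℕ} (m : ℕ+) :
    Nonempty (Metric.closedBall (0 : Rn n) (m : ℝ)) :=
  ⟨⟨0, Metric.mem_closedBall_self (by positivity)⟩⟩

theorem le_supOnBall {n : ℕ} (φ ψ : LipOne n) (m : ℕ+) (t : Rn n) (ht : ‖t‖ ≤ m) :
    |(φ t : ℝ) - (ψ t : ℝ)| ≤ supOnBall φ ψ m := by
  refine le_ciSup (f := fun t : Metric.closedBall (0 : Rn n) (m : ℝ) =>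
    |(φ t : ℝ) - (ψ t : ℝ)|) ⟨1, ?_⟩ ⟨t, by simpa using ht⟩
  rintro _ ⟨s, rfl⟩
  exact abs_sub_le_one φ ψ s

theorem supOnBall_le {n : ℕ} (φ ψ : LipOne n) (m : ℕ+) {c : ℝ}
    (h : ∀ t : Rn n, ‖t‖ ≤ m → |(φ t : ℝ) - (ψ t : ℝ)| ≤ c) : supOnBall φ ψ m ≤ c := by
  have := closedBall_nonempty (n := n) m
  exact ciSup_le fun t => h t (mem_closedBall_zero_iff.mp t.2)

theorem supOnBall_nonneg {n : ℕ} (φ ψ : LipOne n) (m : ℕ+) : 0 ≤ supOnBall φ ψ m :=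
  Real.iSup_nonneg fun _ => abs_nonneg _

theorem le_lipDist {n : ℕ} (φ ψ : LipOne n) (m : ℕ+) :
    ((2 : ℝ) ^ (m : ℕ))⁻¹ * supOnBall φ ψ m ≤ lipDist φ ψ := by
  refine le_ciSup (f := fun m : ℕ+ => ((2 : ℝ) ^ (m : ℕ))⁻¹ * supOnBall φ ψ m) ⟨1, ?_⟩ m
  rintro _ ⟨l, rfl⟩
  have h1 : ((2 : ℝ) ^ (l : ℕ))⁻¹ ≤ 1 := inv_le_one_of_one_le₀ (one_le_pow₀ (by norm_num))
  exact mul_le_one₀ h1 (supOnBall_nonneg φ ψ l)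
    (supOnBall_le φ ψ l fun t _ => abs_sub_le_one φ ψ t)

noncomputable instance (n : ℕ) : MetricSpace (LipOne n) where
  dist := lipDist
  dist_self φ := by simp [lipDist, supOnBall]
  dist_comm φ ψ := by simp only [lipDist, supOnBall, abs_sub_comm]
  dist_triangle φ ψ χ := by
    refine ciSup_le fun m => ?_
    have h : supOnBall φ χ m ≤ supOnBall φ ψ m + supOnBall ψ χ m :=
      supOnBall_le φ χ m fun t ht =>
        (abs_sub_le _ (ψ t : ℝ) _).trans
          (add_le_add (le_supOnBall φ ψ m t ht) (le_supOnBall ψ χ m t ht))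
    calc ((2 : ℝ) ^ (m : ℕ))⁻¹ * supOnBall φ χ m
        ≤ ((2 : ℝ) ^ (m : ℕ))⁻¹ * (supOnBall φ ψ m + supOnBall ψ χ m) := by gcongr
      _ = ((2 : ℝ) ^ (m : ℕ))⁻¹ * supOnBall φ ψ m
          + ((2 : ℝ) ^ (m : ℕ))⁻¹ * supOnBall ψ χ m := mul_add _ _ _
      _ ≤ lipDist φ ψ + lipDist ψ χ := add_le_add (le_lipDist φ ψ m) (le_lipDist ψ χ m)
  eq_of_dist_eq_zero := by
    intro φ ψ h
    ext t
    obtain ⟨m, hm⟩ := exists_nat_ge ‖t‖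
    have ht : ‖t‖ ≤ (m.succPNat : ℕ) := by
      rw [Nat.succPNat_coe]
      push_cast
      linarith
    have h1 := (le_lipDist φ ψ m.succPNat).trans_eq h
    have h2 : (0 : ℝ) < ((2 : ℝ) ^ (m.succPNat : ℕ))⁻¹ := by positivity
    have h3 : supOnBall φ ψ m.succPNat ≤ 0 := by
      by_contra hc
      exact absurd h1 (not_le.mpr (mul_pos h2 (not_le.mp hc)))
    have h4 := (le_supOnBall φ ψ m.succPNat t ht).trans h3
    exact sub_eq_zero.mp (abs_nonpos_iff.mp h4)

/-- The shift action of `ℝⁿ` on `Lip₁(ℝⁿ, I)`: `(u, φ(t)) ↦ φ(t + u)`. -/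
instance (n : ℕ) : AddAction (Rn n) (LipOne n) where
  vadd u φ := ⟨fun t => φ (t + u), fun t s => by simpa using φ.lipschitz (t + u) (s + u)⟩
  zero_vadd φ := by
    ext t
    change ((φ (t + 0) : unitInterval) : ℝ) = φ t
    rw [add_zero]
  add_vadd u v φ := by
    ext t
    change ((φ (t + (u + v)) : unitInterval) : ℝ) = φ (t + u + v)
    rw [add_assoc]

/-- `𝔤ₓ`: the largest linear subspace of `ℝⁿ` all of whose elements fix `x`
(see `isGreatest_stabSubspace`). -/
def stabSubspace (n : ℕ) {X : Type*} [AddAction (Rn n) X] (x : X) : Submodule ℝ (Rn n) :=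
  sSup {W | ∀ t ∈ W, t +ᵥ x = x}

theorem isGreatest_stabSubspace (n : ℕ) {X : Type*} [AddAction (Rn n) X] (x : X) :
    IsGreatest {W : Submodule ℝ (Rn n) | ∀ t ∈ W, t +ᵥ x = x} (stabSubspace n x) := by
  refine ⟨fun t ht => ?_, fun W hW => le_sSup hW⟩
  rw [stabSubspace, sSup_eq_iSup'] at ht
  induction ht using Submodule.iSup_induction' with
  | mem W t ht => exact W.2 t ht
  | zero => exact zero_vadd _ x
  | add s t _ _ hs ht => rw [add_vadd, ht, hs]

/-- `X_k = {x ∈ X | dim 𝔤ₓ ≥ k}`. -/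
def stratum (n : ℕ) (X : Type*) [AddAction (Rn n) X] (k : ℕ) : Set X :=
  {x | k ≤ Module.finrank ℝ (stabSubspace n x)}

/-- `Y_k`: the `φ ∈ Lip₁(ℝⁿ, I)` invariant under the translations by the elements of some linear
subspace of `ℝⁿ` of dimension at least `k`. -/
def invariantFunctions (n k : ℕ) : Set (LipOne n) :=
  {φ | ∃ W : Submodule ℝ (Rn n), k ≤ Module.finrank ℝ W ∧
    ∀ t : Rn n, ∀ u ∈ W, φ (t + u) = φ t}

/-- `𝒞`: the `ℝⁿ`-equivariant continuous maps `f : X → Lip₁(ℝⁿ, I)` with `f = ι` on `X_n`.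
Since `X` is compact, `C(X, LipOne n)`, and hence its subtype `𝒞`, carries the uniform metric
`D(f, g) = sup_x d(f(x), g(x))` (see `dist_eq_iSup`). -/
def equivariantMaps {n : ℕ} {X : Type*} [TopologicalSpace X] [AddAction (Rn n) X]
    (ι : stratum n X n → invariantFunctions n n) : Set C(X, LipOne n) :=
  {f | (∀ (t : Rn n) (x : X), f (t +ᵥ x) = t +ᵥ f x) ∧
    ∀ x : stratum n X n, f (x : X) = (ι x : LipOne n)}

theorem dist_eq_iSup {n : ℕ} {X : Type*} [TopologicalSpace X] [CompactSpace X]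
    [AddAction (Rn n) X] (ι : stratum n X n → invariantFunctions n n)
    (f g : equivariantMaps ι) :
    dist f g = ⨆ x : X, lipDist ((f : C(X, LipOne n)) x) ((g : C(X, LipOne n)) x) :=
  ContinuousMap.dist_eq_iSup

/-- `𝒞_k(A) = {f ∈ 𝒞 | f(A) ∩ Y_{k+1} = ∅}`. -/
def avoidingMaps {n : ℕ} {X : Type*} [TopologicalSpace X] [AddAction (Rn n) X]
    (ι : stratum n X n → invariantFunctions n n) (k : ℕ) (A : Set X) :
    Set (equivariantMaps ι) :=
  {f | (f : C(X, LipOne n)) '' A ∩ invariantFunctions n (k + 1) = ∅}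

end LipEmbedding

/-! Openness holds because `Y_{k+1}` is closed (orthonormal frames form a compact space) and `A` is
compact. Density is the substance.

An equivariant `f` is the same as the scalar function `F x = f x 0`, which takes values in `[0,1]`
and is one-Lipschitz along orbits. Suppose `f x` is invariant under a subspace `W` of dimension at
least `k + 1`. Since `dim 𝔤_p ≤ k`, `W` contains a unit vector orthogonal to `𝔤_p`. The unit sphere
of the orthogonal complement is compact, and each of its points has a multiple `v` moving `p`. It
therefore suffices to forbid, for `x` near `p`, invariance along lines with direction near one such
`v`; finitely many of these open dense conditions cover the sphere.

For one `v` (`exists_perturbation`), replace `F` by its quadratic sup-convolution `S` along orbits.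
It is close to `F`, still one-Lipschitz, and semiconvex (`supConvolution_semiconvex`): its second
differences are at least `-2K|s|²`. Next build a function `τ` that increases along orbits in
directions near `v` (`exists_increasing_coordinate`). A fine triangle wave `B` of `τ` has convex
kinks, with second differences of first order in `s`. Mixing a little of `B` into `S`, through a
cutoff vanishing at fixed points, leaves a kink that semiconvexity cannot cancel, so the result is
not constant along the line. -/

namespace LipEmbedding

/-! ### Suprema along orbits: exponential envelopes and sup-convolutions -/

section Envelopes

variable {E X : Type*} [NormedAddCommGroup E]

/-- Up to `η` the supremum is attained on a compact ball independent of `x`, so the function is a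
uniform limit of suprema over compact balls, which are continuous. -/
theorem continuous_iSup_of_tail [ProperSpace E] [TopologicalSpace X] {Φ : X → E → ℝ}
    (hΦ : Continuous fun q : X × E => Φ q.1 q.2)
    (hb : ∀ x, BddAbove (Set.range (Φ x)))
    (htail : ∀ η > 0, ∃ R : ℝ, ∀ x t, R ≤ ‖t‖ → Φ x t ≤ Φ x 0 + η) :
    Continuous fun x => ⨆ t, Φ x t := by
  refine continuous_of_uniform_approx_of_continuous fun u hu => ?_
  obtain ⟨η, hη, hu⟩ := Metric.mem_uniformity_dist.mp hu
  obtain ⟨R, hR⟩ := htail (η / 2) (half_pos hη)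
  -- `R` may be negative; `max R 0` keeps the comparison point `0` in the ball.
  have hK := isCompact_closedBall (0 : E) (max R 0)
  refine ⟨fun x => sSup (Φ x '' Metric.closedBall 0 (max R 0)), hK.continuous_sSup hΦ,
    fun x => hu ?_⟩
  have hb' : BddAbove (Φ x '' Metric.closedBall 0 (max R 0)) :=
    (hb x).mono (Set.image_subset_range _ _)
  have h0 : (0 : E) ∈ Metric.closedBall (0 : E) (max R 0) :=
    Metric.mem_closedBall_self (le_max_right _ _)
  have h1 : sSup (Φ x '' Metric.closedBall 0 (max R 0)) ≤ ⨆ t, Φ x t :=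
    csSup_le ⟨_, 0, h0, rfl⟩ (by rintro _ ⟨t, _, rfl⟩; exact le_ciSup (hb x) t)
  have h2 : ⨆ t, Φ x t ≤ sSup (Φ x '' Metric.closedBall 0 (max R 0)) + η / 2 := by
    refine ciSup_le fun t => ?_
    by_cases ht : ‖t‖ ≤ max R 0
    · have := le_csSup hb' ⟨t, mem_closedBall_zero_iff.mpr ht, rfl⟩
      linarith
    · have h3 := hR x t ((le_max_left _ _).trans (not_le.mp ht).le)
      have := le_csSup hb' ⟨0, h0, rfl⟩
      linarith
  rw [Real.dist_eq, abs_lt]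
  constructor <;> linarith

variable [AddAction E X]

/-- The envelope `x ↦ sup_t e^{-c|t|} h(t + x)` of a function along orbits. -/
noncomputable def expEnvelope (c : ℝ) (h : X → ℝ) (x : X) : ℝ :=
  ⨆ t : E, Real.exp (-(c * ‖t‖)) * h (t +ᵥ x)

theorem exp_mul_le_one {c a b : ℝ} (hc : 0 ≤ c) (ha : 0 ≤ a) (hb : b ≤ 1) :
    Real.exp (-(c * a)) * b ≤ 1 :=
  calc Real.exp (-(c * a)) * b ≤ Real.exp (-(c * a)) * 1 := by gcongr
    _ ≤ 1 := by
      rw [mul_one, Real.exp_le_one_iff, neg_nonpos]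
      positivity

theorem bddAbove_expEnvelope {c : ℝ} (hc : 0 ≤ c) {h : X → ℝ} (h1 : ∀ x, h x ≤ 1) (x : X) :
    BddAbove (Set.range fun t : E => Real.exp (-(c * ‖t‖)) * h (t +ᵥ x)) := by
  refine ⟨1, ?_⟩
  rintro _ ⟨t, rfl⟩
  exact exp_mul_le_one hc (norm_nonneg t) (h1 _)

theorem le_expEnvelope {c : ℝ} (hc : 0 ≤ c) {h : X → ℝ} (h1 : ∀ x, h x ≤ 1) (x : X) (t : E) :
    Real.exp (-(c * ‖t‖)) * h (t +ᵥ x) ≤ expEnvelope (E := E) c h x :=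
  le_ciSup (bddAbove_expEnvelope hc h1 x) t

theorem self_le_expEnvelope {c : ℝ} (hc : 0 ≤ c) {h : X → ℝ} (h1 : ∀ x, h x ≤ 1) (x : X) :
    h x ≤ expEnvelope (E := E) c h x := by
  simpa using le_expEnvelope hc h1 x (0 : E)

theorem expEnvelope_le_one {c : ℝ} (hc : 0 ≤ c) {h : X → ℝ} (h1 : ∀ x, h x ≤ 1) (x : X) :
    expEnvelope (E := E) c h x ≤ 1 :=
  ciSup_le fun t => exp_mul_le_one hc (norm_nonneg t) (h1 _)

theorem expEnvelope_nonneg (c : ℝ) {h : X → ℝ} (h0 : ∀ x, 0 ≤ h x) (x : X) :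
    0 ≤ expEnvelope (E := E) c h x :=
  Real.iSup_nonneg fun _ => mul_nonneg (Real.exp_pos _).le (h0 _)

/-- The triangle inequality in the exponent. This multiplicative bound yields both the Lipschitz
estimate and the relative decay needed of the cutoff. -/
theorem exp_mul_expEnvelope_le {c : ℝ} (hc : 0 ≤ c) {h : X → ℝ} (h0 : ∀ x, 0 ≤ h x)
    (h1 : ∀ x, h x ≤ 1) (x : X) (s : E) :
    Real.exp (-(c * ‖s‖)) * expEnvelope (E := E) c h x ≤ expEnvelope (E := E) c h (s +ᵥ x) := by
  rw [expEnvelope, Real.mul_iSup_of_nonneg (Real.exp_pos _).le]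
  refine ciSup_le fun t => ?_
  have h2 := le_expEnvelope hc h1 (s +ᵥ x) (t - s)
  rw [vadd_vadd, sub_add_cancel] at h2
  refine le_trans ?_ h2
  rw [← mul_assoc, ← Real.exp_add]
  refine mul_le_mul_of_nonneg_right (Real.exp_le_exp.mpr ?_) (h0 _)
  have := mul_le_mul_of_nonneg_left (norm_sub_le t s) hc
  linarith

theorem one_sub_mul_expEnvelope_le {c : ℝ} (hc : 0 ≤ c) {h : X → ℝ} (h0 : ∀ x, 0 ≤ h x)
    (h1 : ∀ x, h x ≤ 1) (x : X) (s : E) :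
    (1 - c * ‖s‖) * expEnvelope (E := E) c h x ≤ expEnvelope (E := E) c h (s +ᵥ x) := by
  refine le_trans ?_ (exp_mul_expEnvelope_le hc h0 h1 x s)
  refine mul_le_mul_of_nonneg_right ?_ (expEnvelope_nonneg c h0 x)
  have := Real.add_one_le_exp (-(c * ‖s‖))
  linarith

theorem expEnvelope_le_add {c : ℝ} (hc : 0 ≤ c) {h : X → ℝ} (h0 : ∀ x, 0 ≤ h x)
    (h1 : ∀ x, h x ≤ 1) (x : X) (s : E) :
    expEnvelope (E := E) c h x ≤ expEnvelope (E := E) c h (s +ᵥ x) + c * ‖s‖ := by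
  have h2 := one_sub_mul_expEnvelope_le hc h0 h1 x s
  have h3 := mul_le_mul_of_nonneg_left (expEnvelope_le_one (E := E) hc h1 x)
    (mul_nonneg hc (norm_nonneg s))
  linarith

theorem abs_expEnvelope_sub_le {c : ℝ} (hc : 0 ≤ c) {h : X → ℝ} (h0 : ∀ x, 0 ≤ h x)
    (h1 : ∀ x, h x ≤ 1) (x : X) (s : E) :
    |expEnvelope (E := E) c h (s +ᵥ x) - expEnvelope (E := E) c h x| ≤ c * ‖s‖ := by
  have h2 := expEnvelope_le_add hc h0 h1 x s
  have h3 := expEnvelope_le_add hc h0 h1 (s +ᵥ x) (-s)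
  rw [vadd_vadd, neg_add_cancel, zero_vadd, norm_neg] at h3
  rw [abs_le]
  constructor <;> linarith

theorem expEnvelope_eq_zero {c : ℝ} {h : X → ℝ} {x : X} (hx : ∀ t : E, h (t +ᵥ x) = 0) :
    expEnvelope (E := E) c h x = 0 := by
  simp [expEnvelope, hx]

theorem continuous_expEnvelope [ProperSpace E] [TopologicalSpace X] [ContinuousVAdd E X]
    {c : ℝ} (hc : 0 < c) {h : X → ℝ}
    (hh : Continuous h) (h0 : ∀ x, 0 ≤ h x) (h1 : ∀ x, h x ≤ 1) :
    Continuous (expEnvelope (E := E) c h) := by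
  refine continuous_iSup_of_tail (Φ := fun x (t : E) => Real.exp (-(c * ‖t‖)) * h (t +ᵥ x))
    (by fun_prop) (bddAbove_expEnvelope hc.le h1) fun η hη => ⟨-Real.log η / c, fun x t ht => ?_⟩
  rw [div_le_iff₀ hc] at ht
  have h2 : Real.exp (-(c * ‖t‖)) ≤ η := by
    rw [← Real.exp_log hη, Real.exp_le_exp]
    linarith
  have h3 : Real.exp (-(c * ‖t‖)) * h (t +ᵥ x) ≤ Real.exp (-(c * ‖t‖)) * 1 :=
    mul_le_mul_of_nonneg_left (h1 _) (Real.exp_pos _).le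
  have h4 : 0 ≤ Real.exp (-(c * ‖(0 : E)‖)) * h ((0 : E) +ᵥ x) :=
    mul_nonneg (Real.exp_pos _).le (h0 _)
  change _ ≤ Real.exp (-(c * ‖(0 : E)‖)) * h ((0 : E) +ᵥ x) + η
  linarith

/-- The quadratic sup-convolution `x ↦ sup_t (F(t + x) - K|t|²)` along orbits. -/
noncomputable def supConvolution (E : Type*) [NormedAddCommGroup E] [AddAction E X]
    (K : ℝ) (F : X → ℝ) (x : X) : ℝ :=
  ⨆ t : E, (F (t +ᵥ x) - K * ‖t‖ ^ 2)

variable {K : ℝ} {F : X → ℝ}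

theorem bddAbove_supConvolution (hK : 0 ≤ K) (hF1 : ∀ x, F x ≤ 1) (x : X) :
    BddAbove (Set.range fun t : E => F (t +ᵥ x) - K * ‖t‖ ^ 2) := by
  refine ⟨1, ?_⟩
  rintro _ ⟨t, rfl⟩
  have := mul_nonneg hK (sq_nonneg ‖t‖)
  linarith [hF1 (t +ᵥ x)]

theorem le_supConvolution (hK : 0 ≤ K) (hF1 : ∀ x, F x ≤ 1) (x : X) (t : E) :
    F (t +ᵥ x) - K * ‖t‖ ^ 2 ≤ supConvolution E K F x :=
  le_ciSup (bddAbove_supConvolution hK hF1 x) t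

theorem self_le_supConvolution (hK : 0 ≤ K) (hF1 : ∀ x, F x ≤ 1) (x : X) :
    F x ≤ supConvolution E K F x := by
  simpa using le_supConvolution hK hF1 x (0 : E)

theorem supConvolution_le_one (hK : 0 ≤ K) (hF1 : ∀ x, F x ≤ 1) (x : X) :
    supConvolution E K F x ≤ 1 := by
  refine ciSup_le fun t => ?_
  have := mul_nonneg hK (sq_nonneg ‖t‖)
  linarith [hF1 (t +ᵥ x)]

theorem supConvolution_le_add (hK : 0 < K)
    (hF : ∀ x, ∀ t : E, |F (t +ᵥ x) - F x| ≤ ‖t‖) (x : X) :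
    supConvolution E K F x ≤ F x + 1 / (4 * K) := by
  refine ciSup_le fun t => ?_
  have h1 := (abs_le.mp (hF x t)).2
  have h2 : ‖t‖ - K * ‖t‖ ^ 2 ≤ 1 / (4 * K) := by
    rw [le_div_iff₀ (by positivity)]
    nlinarith [sq_nonneg (2 * K * ‖t‖ - 1)]
  linarith

theorem supConvolution_le_vadd (hK : 0 ≤ K) (hF1 : ∀ x, F x ≤ 1)
    (hF : ∀ x, ∀ t : E, |F (t +ᵥ x) - F x| ≤ ‖t‖) (x : X) (s : E) :
    supConvolution E K F x ≤ supConvolution E K F (s +ᵥ x) + ‖s‖ := by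
  refine ciSup_le fun t => ?_
  have h1 := le_supConvolution hK hF1 (s +ᵥ x) t
  have h2 := (abs_le.mp (hF (t +ᵥ x) s)).1
  rw [vadd_vadd, add_comm, ← vadd_vadd] at h2
  linarith

theorem abs_supConvolution_sub_le (hK : 0 ≤ K) (hF1 : ∀ x, F x ≤ 1)
    (hF : ∀ x, ∀ t : E, |F (t +ᵥ x) - F x| ≤ ‖t‖) (x : X) (s : E) :
    |supConvolution E K F (s +ᵥ x) - supConvolution E K F x| ≤ ‖s‖ := by
  have h2 := supConvolution_le_vadd hK hF1 hF x s
  have h3 := supConvolution_le_vadd hK hF1 hF (s +ᵥ x) (-s)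
  rw [vadd_vadd, neg_add_cancel, zero_vadd, norm_neg] at h3
  rw [abs_le]
  constructor <;> linarith

theorem supConvolution_eq_of_fixed (hK : 0 ≤ K) (hF1 : ∀ x, F x ≤ 1) {x : X}
    (hx : ∀ t : E, t +ᵥ x = x) : supConvolution E K F x = F x := by
  refine le_antisymm (ciSup_le fun t => ?_) (self_le_supConvolution hK hF1 x)
  rw [hx t]
  have := mul_nonneg hK (sq_nonneg ‖t‖)
  linarith

theorem continuous_supConvolution [ProperSpace E] [TopologicalSpace X] [ContinuousVAdd E X]
    (hK : 0 < K) (hFc : Continuous F)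
    (hF1 : ∀ x, F x ≤ 1) (hF : ∀ x, ∀ t : E, |F (t +ᵥ x) - F x| ≤ ‖t‖) :
    Continuous (supConvolution E K F) := by
  refine continuous_iSup_of_tail (Φ := fun x (t : E) => F (t +ᵥ x) - K * ‖t‖ ^ 2)
    (by fun_prop) (bddAbove_supConvolution hK.le hF1) fun η hη => ⟨1 / K, fun x t ht => ?_⟩
  have h1 := (abs_le.mp (hF x t)).2
  rw [div_le_iff₀ hK] at ht
  have h2 := mul_le_mul_of_nonneg_right ht (norm_nonneg t)
  simp only [norm_zero, zero_vadd]
  nlinarith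

/-- A competitor `t` at `x` becomes `t - s` at `s + x` and `t + s` at `-s + x`, reaching the same
point; the parallelogram law compares the penalties. -/
theorem supConvolution_semiconvex {E : Type*} [NormedAddCommGroup E] [InnerProductSpace ℝ E]
    [AddAction E X] (hK : 0 ≤ K) (hF1 : ∀ x, F x ≤ 1) (x : X) (s : E) :
    2 * supConvolution E K F x - 2 * K * ‖s‖ ^ 2 ≤
      supConvolution E K F (s +ᵥ x) + supConvolution E K F (-s +ᵥ x) := by
  have key : supConvolution E K F x ≤
      (supConvolution E K F (s +ᵥ x) + supConvolution E K F (-s +ᵥ x)) / 2 + K * ‖s‖ ^ 2 := by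
    refine ciSup_le fun t => ?_
    have h1 := le_supConvolution hK hF1 (s +ᵥ x) (t - s)
    have h2 := le_supConvolution hK hF1 (-s +ᵥ x) (t + s)
    rw [vadd_vadd, sub_add_cancel] at h1
    rw [vadd_vadd, add_neg_cancel_right] at h2
    have h3 := parallelogram_law_with_norm ℝ t s
    nlinarith
  linarith

end Envelopes

/-! ### Triangle waves -/

section TriangleWave

/-- The triangle wave of slope one vanishing on `l • ℤ`. -/
noncomputable def triangleWave (l y : ℝ) : ℝ :=
  Metric.infDist y (Set.range fun j : ℤ => l * j)

theorem triangleWave_nonneg (l y : ℝ) : 0 ≤ triangleWave l y := Metric.infDist_nonneg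

theorem continuous_triangleWave (l : ℝ) : Continuous (triangleWave l) :=
  Metric.continuous_infDist_pt _

theorem abs_triangleWave_sub_le (l y z : ℝ) : |triangleWave l y - triangleWave l z| ≤ |y - z| := by
  have h1 := Metric.infDist_le_infDist_add_dist (x := y) (y := z)
    (s := Set.range fun j : ℤ => l * j)
  have h2 := Metric.infDist_le_infDist_add_dist (x := z) (y := y)
    (s := Set.range fun j : ℤ => l * j)
  rw [dist_comm] at h2
  rw [Real.dist_eq] at h1 h2
  unfold triangleWave
  rw [abs_le]
  constructor <;> linarith

theorem triangleWave_intCast_mul (l : ℝ) (j : ℤ) : triangleWave l (l * j) = 0 :=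
  Metric.infDist_zero_of_mem ⟨j, rfl⟩

theorem triangleWave_le {l : ℝ} (hl : 0 < l) (y : ℝ) : triangleWave l y ≤ l := by
  refine (Metric.infDist_le_dist_of_mem (Set.mem_range_self ⌊y / l⌋)).trans ?_
  have h1 := Int.floor_le (y / l)
  have h2 := Int.lt_floor_add_one (y / l)
  rw [le_div_iff₀ hl] at h1
  rw [div_lt_iff₀ hl] at h2
  rw [Real.dist_eq, abs_le]
  constructor <;> nlinarith

/-- Within `l / 2` of `l * j` no other multiple of `l` is closer. Hence the wave has a convex kink
there, of slope one on both sides. -/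
theorem le_triangleWave {l : ℝ} (hl : 0 < l) (j : ℤ) {y : ℝ} (hd : |y - l * j| ≤ l / 2) :
    |y - l * j| ≤ triangleWave l y := by
  refine (Metric.le_infDist (Set.range_nonempty _)).mpr ?_
  rintro _ ⟨i, rfl⟩
  rw [Real.dist_eq]
  by_cases hij : i = j
  · rw [hij]
  · have h1 : (1 : ℝ) ≤ |(j : ℝ) - i| := by
      exact_mod_cast Int.one_le_abs (sub_ne_zero.mpr (Ne.symm hij))
    have h2 : l ≤ |l * j - l * i| := by
      rw [← mul_sub, abs_mul, abs_of_pos hl]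
      nlinarith
    have h3 := abs_sub_abs_le_abs_sub (l * j - l * i) (l * j - y)
    rw [abs_sub_comm (l * (j : ℝ)) y, sub_sub_sub_cancel_left] at h3
    linarith

end TriangleWave

/-! ### Separating functions and cutoffs with controlled variation along orbits -/

section Functions

variable {E X : Type*} [NormedAddCommGroup E] [ProperSpace E] [MetricSpace X] [AddAction E X]
  [ContinuousVAdd E X]

/-- The cone of height one and radius `r` around `p`. -/
noncomputable def cone (p : X) (r : ℝ) (x : X) : ℝ := max 0 (1 - dist x p / r)

theorem cone_nonneg (p : X) (r : ℝ) (x : X) : 0 ≤ cone p r x := le_max_left _ _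

theorem cone_le_one (p : X) {r : ℝ} (hr : 0 < r) (x : X) : cone p r x ≤ 1 :=
  max_le zero_le_one (sub_le_self _ (by positivity))

theorem cone_self (p : X) (r : ℝ) : cone p r p = 1 := by simp [cone]

theorem cone_eq_zero {p : X} {r : ℝ} (hr : 0 < r) {x : X} (hx : r ≤ dist x p) :
    cone p r x = 0 := by
  refine max_eq_left ?_
  rw [sub_nonpos, le_div_iff₀ hr, one_mul]
  exact hx

theorem continuous_cone (p : X) (r : ℝ) : Continuous (cone p r) := by
  unfold cone
  fun_prop

/-- Minus the envelope of a cone at `p`. The envelope is at least `1` at `p`. Seen from `y`, short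
translates miss the cone, and translates of length at least `ρ` carry weight at most `exp (-4) ≤ 1 /
4`. -/
theorem exists_orbit_lipschitz_separating {p y : X} (hy : y ≠ p) :
    ∃ c > 0, ∃ g : X → ℝ, Continuous g ∧ (∀ x, ∀ t : E, |g (t +ᵥ x) - g x| ≤ c * ‖t‖) ∧
      1 / 2 < g y - g p := by
  have hr : 0 < dist y p / 2 := half_pos (dist_pos.mpr hy)
  have hcont : Continuous fun t : E => dist (t +ᵥ y) p := by fun_prop
  have hev : ∀ᶠ t : E in 𝓝 0, dist y p / 2 < dist (t +ᵥ y) p := by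
    refine hcont.continuousAt.eventually (lt_mem_nhds ?_)
    simp only [zero_vadd]
    linarith
  obtain ⟨ρ, hρ, hball⟩ := Metric.eventually_nhds_iff.mp hev
  have hc : 0 < 4 / ρ := by positivity
  have hc0 := cone_nonneg p (dist y p / 2)
  have hc1 := cone_le_one p hr
  refine ⟨4 / ρ, hc, fun x => -expEnvelope (E := E) (4 / ρ) (cone p (dist y p / 2)) x,
    (continuous_expEnvelope hc (continuous_cone _ _) hc0 hc1).neg, fun x t => ?_, ?_⟩
  · rw [neg_sub_neg, abs_sub_comm]
    exact abs_expEnvelope_sub_le hc.le hc0 hc1 x t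
  · have h1 := self_le_expEnvelope (E := E) hc.le hc1 p
    rw [cone_self] at h1
    have h2 : expEnvelope (E := E) (4 / ρ) (cone p (dist y p / 2)) y ≤ 1 / 4 := by
      refine ciSup_le fun t => ?_
      by_cases ht : ‖t‖ < ρ
      · rw [cone_eq_zero hr (hball (by simpa using ht)).le, mul_zero]
        norm_num
      · have h3 : 4 ≤ 4 / ρ * ‖t‖ := by
          rw [div_mul_eq_mul_div, le_div_iff₀ hρ]
          linarith
        have h4 : Real.exp (-(4 / ρ * ‖t‖)) ≤ 1 / 4 := by
          rw [Real.exp_neg, ← one_div]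
          exact one_div_le_one_div_of_le (by norm_num)
            (by linarith [Real.add_one_le_exp (4 / ρ * ‖t‖)])
        calc _ ≤ Real.exp (-(4 / ρ * ‖t‖)) * 1 :=
              mul_le_mul_of_nonneg_left (hc1 _) (Real.exp_pos _).le
          _ ≤ 1 / 4 := by rwa [mul_one]
    linarith

/-- The vector `v` moves every point of a small ball around `p`, so fixed points lie outside it and
the envelope of a cone supported there vanishes at them. Doubling and truncating makes the cutoff
equal to `1` near `p`. -/
theorem exists_cutoff {p : X} {v : E} (hv : v +ᵥ p ≠ p) :
    ∃ h : X → ℝ, Continuous h ∧ (∀ x, 0 ≤ h x) ∧ (∀ x, h x ≤ 1) ∧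
      (∀ x, ∀ t : E, (1 - ‖t‖ / 2) * h x ≤ h (t +ᵥ x)) ∧
      (∀ x, (∀ t : E, t +ᵥ x = x) → h x = 0) ∧ ∀ᶠ x in 𝓝 p, h x = 1 := by
  have hopen : IsOpen {x : X | v +ᵥ x ≠ x} :=
    isOpen_ne_fun (continuous_const_vadd v) continuous_id
  obtain ⟨r, hr, hball⟩ := Metric.isOpen_iff.mp hopen p hv
  have hc0 := cone_nonneg p r
  have hc1 := cone_le_one p hr
  have hhalf : (0 : ℝ) < 1 / 2 := by norm_num
  have hcont := continuous_expEnvelope (E := E) hhalf (continuous_cone p r) hc0 hc1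
  have hnn := expEnvelope_nonneg (E := E) (1 / 2) hc0
  refine ⟨fun x => min 1 (2 * expEnvelope (E := E) (1 / 2) (cone p r) x), by fun_prop,
    fun x => le_min zero_le_one (by linarith [hnn x]), fun x => min_le_left _ _,
    fun x t => ?_, fun x hx => ?_, ?_⟩
  · have h1 := one_sub_mul_expEnvelope_le hhalf.le hc0 hc1 x t
    have h2 := norm_nonneg t
    have h3 : 0 ≤ min 1 (2 * expEnvelope (E := E) (1 / 2) (cone p r) x) :=
      le_min zero_le_one (by linarith [hnn x])
    have h4 := min_le_left 1 (2 * expEnvelope (E := E) (1 / 2) (cone p r) x)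
    have h5 := min_le_right 1 (2 * expEnvelope (E := E) (1 / 2) (cone p r) x)
    refine le_min ?_ ?_
    · nlinarith
    · rcases le_total 0 (1 - ‖t‖ / 2) with h | h
      · nlinarith
      · nlinarith [hnn (t +ᵥ x)]
  · have h1 : r ≤ dist x p := by
      by_contra hlt
      exact hball (Metric.mem_ball.mpr (not_le.mp hlt)) (hx v)
    have h2 : expEnvelope (E := E) (1 / 2) (cone p r) x = 0 :=
      expEnvelope_eq_zero fun t => by rw [hx t, cone_eq_zero hr h1]
    simp only [h2, mul_zero, zero_le_one, inf_of_le_right]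
  · have h1 : ∀ᶠ x in 𝓝 p, 1 / 2 < expEnvelope (E := E) (1 / 2) (cone p r) x := by
      refine hcont.continuousAt.eventually (lt_mem_nhds ?_)
      have := self_le_expEnvelope (E := E) hhalf.le hc1 p
      rw [cone_self] at this
      linarith
    filter_upwards [h1] with x hx
    exact min_eq_left (by linarith)

end Functions

/-! ### A coordinate increasing along orbits near `p` -/

section Coordinate

theorem integral_translate_sub {φ : ℝ → ℝ} (hφ : Continuous φ) (σ : ℝ) :
    (∫ u in (0 : ℝ)..1, φ (u + σ)) - ∫ u in (0 : ℝ)..1, φ u =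
      ∫ u in (0 : ℝ)..σ, (φ (u + 1) - φ u) := by
  have hi : ∀ a b, IntervalIntegrable φ MeasureTheory.volume a b := hφ.intervalIntegrable
  have hi' : IntervalIntegrable (fun u => φ (u + 1)) MeasureTheory.volume 0 σ :=
    Continuous.intervalIntegrable (by fun_prop) _ _
  rw [intervalIntegral.integral_sub hi' (hi _ _),
    intervalIntegral.integral_comp_add_right, intervalIntegral.integral_comp_add_right]
  have h1 := intervalIntegral.integral_add_adjacent_intervals (hi 0 σ) (hi σ (1 + σ))
  have h2 := intervalIntegral.integral_add_adjacent_intervals (hi 0 1) (hi 1 (1 + σ))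
  rw [zero_add, zero_add, add_comm σ 1]
  linarith

variable {E X : Type*} [NormedAddCommGroup E] [NormedSpace ℝ E] [MetricSpace X]
  [AddAction E X] [ContinuousVAdd E X]

theorem exists_nhds_smul_vadd_mem {p : X} {O : Set X} (hO : O ∈ 𝓝 p) (v : E) :
    ∃ ρ > 0, ∃ U ∈ 𝓝 p, ∃ N ∈ 𝓝 v, ∀ x ∈ U, ∀ w ∈ N, ∀ u r : ℝ, |u| < ρ → |r| < ρ →
      u • v +ᵥ (r • w +ᵥ x) ∈ O := by
  have hc : Continuous fun q : (ℝ × ℝ) × E × X => q.1.1 • v +ᵥ (q.1.2 • q.2.1 +ᵥ q.2.2) := by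
    fun_prop
  have hev : ∀ᶠ q : (ℝ × ℝ) × E × X in 𝓝 ((0, 0), v, p),
      q.1.1 • v +ᵥ (q.1.2 • q.2.1 +ᵥ q.2.2) ∈ O :=
    hc.continuousAt.eventually (by simpa using hO)
  rw [nhds_prod_eq, Filter.eventually_prod_iff] at hev
  obtain ⟨P, hP, Q, hQ, hPQ⟩ := hev
  obtain ⟨ρ, hρ, hball⟩ := Metric.eventually_nhds_iff.mp hP
  rw [nhds_prod_eq, Filter.eventually_prod_iff] at hQ
  obtain ⟨N, hN, U, hU, hNU⟩ := hQ
  refine ⟨ρ, hρ, {x | U x}, hU, {w | N w}, hN, fun x hx w hw u r hu hr => ?_⟩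
  refine hPQ (x := (u, r)) (hball ?_) (y := (w, x)) (hNU hw hx)
  simpa [Prod.dist_eq] using ⟨hu, hr⟩

/-- The average of `g` along the orbit segment from `x` to `v + x`. -/
noncomputable def orbitAverage (v : E) (g : X → ℝ) (x : X) : ℝ :=
  ∫ u in (0 : ℝ)..1, g (u • v +ᵥ x)

theorem continuous_orbitAverage {g : X → ℝ} (hg : Continuous g) (v : E) :
    Continuous (orbitAverage v g) :=
  intervalIntegral.continuous_parametric_intervalIntegral_of_continuous' (by fun_prop) _ _

theorem abs_orbitAverage_sub_le {g : X → ℝ} (hg : Continuous g) {c : ℝ}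
    (hlip : ∀ x, ∀ t : E, |g (t +ᵥ x) - g x| ≤ c * ‖t‖) (v : E) (x : X) (t : E) :
    |orbitAverage v g (t +ᵥ x) - orbitAverage v g x| ≤ c * ‖t‖ := by
  have h1 := intervalIntegral.norm_integral_le_of_norm_le_const (a := (0 : ℝ)) (b := 1)
    (f := fun u => g (u • v +ᵥ (t +ᵥ x)) - g (u • v +ᵥ x)) (C := c * ‖t‖) fun u _ => by
      rw [vadd_comm]
      exact hlip _ t
  rwa [intervalIntegral.integral_sub (Continuous.intervalIntegrable (by fun_prop) _ _)
    (Continuous.intervalIntegrable (by fun_prop) _ _), Real.norm_eq_abs, sub_zero, abs_one,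
    mul_one] at h1

/-- The derivative of the average along `v` is `g (v + x) - g x`, so a gap between the values of `g`
at the two ends becomes a rate of increase. -/
theorem half_mul_le_orbitAverage_sub {g : X → ℝ} (hg : Continuous g) {v : E} {y : X} {s : ℝ}
    (hs : 0 ≤ s)
    (h : ∀ u ∈ Set.Icc 0 s, 1 / 2 < g (v +ᵥ (u • v +ᵥ y)) - g (u • v +ᵥ y)) :
    1 / 2 * s ≤ orbitAverage v g (s • v +ᵥ y) - orbitAverage v g y := by
  unfold orbitAverage
  have hφ : Continuous fun u : ℝ => g (u • v +ᵥ y) := by fun_prop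
  have h1 := integral_translate_sub hφ s
  simp only [add_smul, ← vadd_vadd] at h1
  rw [h1]
  have h2 : ∫ _ in (0 : ℝ)..s, (1 / 2 : ℝ) = 1 / 2 * s := by
    rw [intervalIntegral.integral_const, smul_eq_mul, sub_zero, mul_comm]
  rw [← h2]
  refine intervalIntegral.integral_mono_on hs intervalIntegrable_const
    (Continuous.intervalIntegrable (by fun_prop) _ _) fun u hu => ?_
  have h3 := (h u hu).le
  rwa [vadd_comm, ← one_smul ℝ v, smul_smul, mul_one] at h3

theorem exists_increasing_coordinate [ProperSpace E] {p : X} {v : E} (hv : v +ᵥ p ≠ p) :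
    ∃ a > 0, ∃ τ : X → ℝ, Continuous τ ∧ (∀ x, ∀ t : E, |τ (t +ᵥ x) - τ x| ≤ ‖t‖ / 2) ∧
      ∃ ρ > 0, ∃ U ∈ 𝓝 p, ∃ N ∈ 𝓝 v, ∀ x ∈ U, ∀ w ∈ N, ∀ r s : ℝ, |r| < ρ → 0 ≤ s → s < ρ →
        a * s ≤ τ (s • w +ᵥ (r • w +ᵥ x)) - τ (r • w +ᵥ x) := by
  obtain ⟨c, hc, g, hg, hlip, hsep⟩ := exists_orbit_lipschitz_separating (E := E) hv
  have hO : {x | (1 / 2 : ℝ) < g (v +ᵥ x) - g x} ∈ 𝓝 p := by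
    have hcont : Continuous fun x => g (v +ᵥ x) - g x := by fun_prop
    exact hcont.continuousAt.eventually (lt_mem_nhds hsep)
  obtain ⟨ρ, hρ, U, hU, N, hN, hUN⟩ := exists_nhds_smul_vadd_mem hO v
  have hd : 0 < 1 / (4 * c) := by positivity
  have hτlip : ∀ x, ∀ t : E, |(1 / (2 * c) : ℝ) * orbitAverage v g (t +ᵥ x) -
      1 / (2 * c) * orbitAverage v g x| ≤ ‖t‖ / 2 := by
    intro x t
    rw [← mul_sub, abs_mul, abs_of_pos (by positivity : 0 < 1 / (2 * c))]
    calc _ ≤ 1 / (2 * c) * (c * ‖t‖) := by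
          gcongr
          exact abs_orbitAverage_sub_le hg hlip v x t
      _ = ‖t‖ / 2 := by field_simp
  -- The factor `1 / (2c)` makes `τ` half-Lipschitz with slope at least `1 / (4c)` along `v`.
  -- Replacing `v` by `w` within `1 / (4c)` costs at most `1 / (8c)`.
  refine ⟨1 / (8 * c), by positivity, fun x => 1 / (2 * c) * orbitAverage v g x,
    continuous_const.mul (continuous_orbitAverage hg v), hτlip, ρ, hρ, U, hU,
    N ∩ Metric.ball v (1 / (4 * c)),
    Filter.inter_mem hN (Metric.ball_mem_nhds v hd), fun x hx w hw r s hr hs hsρ => ?_⟩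
  have h1 := half_mul_le_orbitAverage_sub hg (v := v) (y := r • w +ᵥ x) hs fun u hu =>
    hUN x hx w hw.1 u r (by rw [abs_of_nonneg hu.1]; exact hu.2.trans_lt hsρ) hr
  have h2 := (abs_le.mp (hτlip (s • v +ᵥ (r • w +ᵥ x)) (s • (w - v)))).1
  rw [vadd_vadd (s • (w - v)), ← smul_add, sub_add_cancel, norm_smul, Real.norm_eq_abs,
    abs_of_nonneg hs] at h2
  have h3 : ‖w - v‖ < 1 / (4 * c) := by simpa [dist_eq_norm] using hw.2
  have h4 := mul_le_mul_of_nonneg_left h1 (by positivity : 0 ≤ 1 / (2 * c))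
  have h5 := mul_le_mul_of_nonneg_left h3.le hs
  have h6 : 1 / (2 * c) * (1 / 2 * s) = 2 * (1 / (8 * c) * s) := by field_simp; ring
  have h7 : s * (1 / (4 * c)) = 2 * (1 / (8 * c) * s) := by field_simp; ring
  linarith

end Coordinate

/-! ### Perturbation destroying constancy along lines -/

section Perturbation

variable {E X : Type*} [NormedAddCommGroup E] [AddAction E X]

/-- The slope budget is exact: with `h` evaluated at the larger end, `(1 - δh) + δh/2 + δh/2 = 1`.
The last term, from the variation of `h`, is affordable because `h` decays only relative to its own
size. -/
theorem abs_interpolate_sub_le {δ : ℝ} (hδ0 : 0 ≤ δ) (hδ1 : δ ≤ 1) {F B h : X → ℝ}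
    (hF0 : ∀ x, 0 ≤ F x) (hF1 : ∀ x, F x ≤ 1) (hB0 : ∀ x, 0 ≤ B x) (hB1 : ∀ x, B x ≤ 1)
    (hh0 : ∀ x, 0 ≤ h x) (hh1 : ∀ x, h x ≤ 1)
    (hF : ∀ x, ∀ t : E, |F (t +ᵥ x) - F x| ≤ ‖t‖)
    (hB : ∀ x, ∀ t : E, |B (t +ᵥ x) - B x| ≤ ‖t‖ / 2)
    (hh : ∀ x, ∀ t : E, (1 - ‖t‖ / 2) * h x ≤ h (t +ᵥ x)) (x : X) (t : E) :
    |(F (t +ᵥ x) + δ * h (t +ᵥ x) * (B (t +ᵥ x) - F (t +ᵥ x))) -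
      (F x + δ * h x * (B x - F x))| ≤ ‖t‖ := by
  have key : ∀ x, ∀ t : E, h (t +ᵥ x) ≤ h x →
      |(F (t +ᵥ x) + δ * h (t +ᵥ x) * (B (t +ᵥ x) - F (t +ᵥ x))) -
        (F x + δ * h x * (B x - F x))| ≤ ‖t‖ := by
    intro x t hle
    have e : (F (t +ᵥ x) + δ * h (t +ᵥ x) * (B (t +ᵥ x) - F (t +ᵥ x))) -
        (F x + δ * h x * (B x - F x)) = (1 - δ * h x) * (F (t +ᵥ x) - F x) +
        δ * h x * (B (t +ᵥ x) - B x) +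
        δ * (h (t +ᵥ x) - h x) * (B (t +ᵥ x) - F (t +ᵥ x)) := by ring
    have hδh : 0 ≤ δ * h x := mul_nonneg hδ0 (hh0 x)
    have hδh1 : δ * h x ≤ 1 := mul_le_one₀ hδ1 (hh0 x) (hh1 x)
    have h1 : |(1 - δ * h x) * (F (t +ᵥ x) - F x)| ≤ (1 - δ * h x) * ‖t‖ := by
      rw [abs_mul, abs_of_nonneg (by linarith)]
      exact mul_le_mul_of_nonneg_left (hF x t) (by linarith)
    have h2 : |δ * h x * (B (t +ᵥ x) - B x)| ≤ δ * h x * (‖t‖ / 2) := by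
      rw [abs_mul, abs_of_nonneg hδh]
      exact mul_le_mul_of_nonneg_left (hB x t) hδh
    have h3 : |δ * (h (t +ᵥ x) - h x) * (B (t +ᵥ x) - F (t +ᵥ x))| ≤
        δ * (‖t‖ / 2 * h x) * 1 := by
      rw [abs_mul, abs_mul, abs_of_nonneg hδ0]
      refine mul_le_mul (mul_le_mul_of_nonneg_left ?_ hδ0) ?_ (abs_nonneg _)
        (mul_nonneg hδ0 (mul_nonneg (by positivity) (hh0 x)))
      · rw [abs_of_nonpos (by linarith)]
        linarith [hh x t]
      · rw [abs_le]
        constructor <;>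
          linarith [hF0 (t +ᵥ x), hF1 (t +ᵥ x), hB0 (t +ᵥ x), hB1 (t +ᵥ x)]
    rw [e]
    refine (abs_add_three _ _ _).trans ?_
    linarith
  rcases le_total (h (t +ᵥ x)) (h x) with hle | hle
  · exact key x t hle
  · have := key (t +ᵥ x) (-t) (by rwa [neg_vadd_vadd])
    rwa [neg_vadd_vadd, norm_neg, abs_sub_comm] at this

/-- The rise over `[0, ρ / 2]` is at least `l`, so the first multiple of `l` above `f 0` is
attained. -/
theorem exists_kink {a ρ l : ℝ} (hl : 0 < l) (hla : 2 * l ≤ a * ρ)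
    {f : ℝ → ℝ} (hf : Continuous f) (hρ : 0 < ρ) (hinc : a * (ρ / 2) ≤ f (ρ / 2) - f 0) :
    ∃ r, 0 ≤ r ∧ r ≤ ρ / 2 ∧ ∃ j : ℤ, f r = l * j := by
  have h1 := Int.ceil_lt_add_one (f 0 / l)
  have h2 := Int.le_ceil (f 0 / l)
  rw [div_le_iff₀ hl] at h2
  have h1' : (⌈f 0 / l⌉ : ℝ) * l < f 0 + l := by
    have := mul_lt_mul_of_pos_right h1 hl
    rwa [add_mul, div_mul_cancel₀ _ hl.ne', one_mul] at this
  have hmem : l * (⌈f 0 / l⌉ : ℝ) ∈ Set.Icc (f 0) (f (ρ / 2)) := ⟨by linarith, by linarith⟩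
  obtain ⟨r, hr, hfr⟩ := intermediate_value_Icc (by positivity : (0 : ℝ) ≤ ρ / 2)
    hf.continuousOn hmem
  exact ⟨r, hr.1, hr.2, _, hfr⟩

variable [InnerProductSpace ℝ E] [ProperSpace E]
  [MetricSpace X] [ContinuousVAdd E X]

/-- `U` and `N` are chosen before `F` and `ε`, so that one finite cover of directions serves every
map. -/
theorem exists_perturbation {p : X} {v : E} (hv : v +ᵥ p ≠ p) :
    ∃ U ∈ 𝓝 p, ∃ N ∈ 𝓝 v, ∀ F : X → ℝ, Continuous F → (∀ x, 0 ≤ F x) → (∀ x, F x ≤ 1) →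
      (∀ x, ∀ t : E, |F (t +ᵥ x) - F x| ≤ ‖t‖) → ∀ ε > 0, ∃ G : X → ℝ, Continuous G ∧
      (∀ x, 0 ≤ G x) ∧ (∀ x, G x ≤ 1) ∧ (∀ x, ∀ t : E, |G (t +ᵥ x) - G x| ≤ ‖t‖) ∧
      (∀ x, (∀ t : E, t +ᵥ x = x) → G x = F x) ∧ (∀ x, |G x - F x| ≤ ε) ∧
      ∀ x ∈ U, ∀ w ∈ N, ∃ s : ℝ, G (s • w +ᵥ x) ≠ G x := by
  obtain ⟨h, hhc, hh0, hh1, hh, hhfix, hhone⟩ := exists_cutoff hv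
  obtain ⟨a, ha, τ, hτc, hτ, ρ₁, hρ₁, U₁, hU₁, N₁, hN₁, hslope⟩ := exists_increasing_coordinate hv
  obtain ⟨ρ₂, hρ₂, U₂, hU₂, N₂, hN₂, hone⟩ := exists_nhds_smul_vadd_mem hhone v
  refine ⟨U₁ ∩ U₂, Filter.inter_mem hU₁ hU₂, N₁ ∩ N₂ ∩ Metric.ball v 1,
    Filter.inter_mem (Filter.inter_mem hN₁ hN₂) (Metric.ball_mem_nhds v one_pos),
    fun F hFc hF0 hF1 hF ε hε => ?_⟩
  -- Half of `ε` pays for mixing in `B`, the other half for the sup-convolution error `1 / (4K)`.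
  obtain ⟨δ, hδ, hδ1, hδε⟩ : ∃ δ : ℝ, 0 < δ ∧ δ ≤ 1 ∧ δ ≤ ε / 2 :=
    ⟨min 1 (ε / 2), by positivity, min_le_left _ _, min_le_right _ _⟩
  obtain ⟨K, hK, hKε⟩ : ∃ K : ℝ, 0 < K ∧ 1 / (4 * K) = ε / 2 :=
    ⟨1 / (2 * ε), by positivity, by field_simp; norm_num⟩
  obtain ⟨ρ, hρ, hρρ₁, hρρ₂⟩ : ∃ ρ : ℝ, 0 < ρ ∧ ρ < ρ₁ ∧ ρ < ρ₂ :=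
    ⟨min ρ₁ ρ₂ / 2, by positivity, by linarith [min_le_left ρ₁ ρ₂, lt_min hρ₁ hρ₂],
      by linarith [min_le_right ρ₁ ρ₂, lt_min hρ₁ hρ₂]⟩
  have hW : 0 < ‖v‖ + 1 := by positivity
  have hW1 : 1 ≤ ‖v‖ + 1 := by linarith [norm_nonneg v]
  -- The four bounds on `l` respectively give `B ≤ 1`, keep `r ± s` in `[-ρ, ρ]`, force a kink, and
  -- make the semiconvexity defect smaller than the kink.
  obtain ⟨l, hl, hl1, hlρ, hlaρ, hlK⟩ : ∃ l : ℝ, 0 < l ∧ l ≤ 1 ∧ l ≤ ρ / 2 ∧ l ≤ a * ρ / 2 ∧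
      l ≤ δ * a / (2 * (K * (‖v‖ + 1))) :=
    ⟨min (min 1 (ρ / 2)) (min (a * ρ / 2) (δ * a / (2 * (K * (‖v‖ + 1))))), by positivity,
      (min_le_left _ _).trans (min_le_left _ _), (min_le_left _ _).trans (min_le_right _ _),
      (min_le_right _ _).trans (min_le_left _ _), (min_le_right _ _).trans (min_le_right _ _)⟩
  rw [le_div_iff₀ (by positivity)] at hlK
  set S := supConvolution E K F with hS
  have hSc : Continuous S := continuous_supConvolution hK hFc hF1 hF
  have hSF : ∀ x, F x ≤ S x := self_le_supConvolution hK.le hF1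
  have hS0 : ∀ x, 0 ≤ S x := fun x => (hF0 x).trans (hSF x)
  have hS1 : ∀ x, S x ≤ 1 := supConvolution_le_one hK.le hF1
  have hSlip : ∀ x, ∀ t : E, |S (t +ᵥ x) - S x| ≤ ‖t‖ := abs_supConvolution_sub_le hK.le hF1 hF
  set B : X → ℝ := fun x => triangleWave l (τ x) with hB
  have hBc : Continuous B := (continuous_triangleWave l).comp hτc
  have hB0 : ∀ x, 0 ≤ B x := fun x => triangleWave_nonneg _ _
  have hB1 : ∀ x, B x ≤ 1 := fun x => (triangleWave_le hl _).trans hl1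
  have hBlip : ∀ x, ∀ t : E, |B (t +ᵥ x) - B x| ≤ ‖t‖ / 2 := fun x t =>
    (abs_triangleWave_sub_le l _ _).trans (hτ x t)
  have hδh0 : ∀ x, 0 ≤ δ * h x := fun x => mul_nonneg hδ.le (hh0 x)
  have hδh1 : ∀ x, δ * h x ≤ 1 := fun x => mul_le_one₀ hδ1 (hh0 x) (hh1 x)
  refine ⟨fun x => S x + δ * h x * (B x - S x), by fun_prop, fun x => ?_, fun x => ?_,
    abs_interpolate_sub_le hδ.le hδ1 hS0 hS1 hB0 hB1 hh0 hh1 hSlip hBlip hh, fun x hx => ?_,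
    fun x => ?_, fun x hx w hw => ?_⟩
  · have h1 := mul_nonneg (hδh0 x) (hB0 x)
    have h2 := mul_nonneg (sub_nonneg.mpr (hδh1 x)) (hS0 x)
    linarith
  · have h1 := mul_nonneg (hδh0 x) (sub_nonneg.mpr (hB1 x))
    have h2 := mul_nonneg (sub_nonneg.mpr (hδh1 x)) (sub_nonneg.mpr (hS1 x))
    linarith
  · simp only [hhfix x hx, mul_zero, zero_mul, add_zero]
    exact supConvolution_eq_of_fixed hK.le hF1 hx
  · have h1 : |δ * h x * (B x - S x)| ≤ δ * 1 := by
      rw [abs_mul, abs_of_nonneg (hδh0 x)]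
      refine mul_le_mul (mul_le_of_le_one_right hδ.le (hh1 x)) ?_ (abs_nonneg _) hδ.le
      rw [abs_le]
      constructor <;> linarith [hB0 x, hB1 x, hS0 x, hS1 x]
    have h2 : S x ≤ F x + 1 / (4 * K) := supConvolution_le_add hK hF x
    have h3 := hSF x
    rw [abs_le] at h1 ⊢
    constructor <;> linarith
  · by_contra! hconst
    obtain ⟨⟨hw1, hw2⟩, hwv⟩ := hw
    have hwW : ‖w‖ ≤ ‖v‖ + 1 := by
      have h1 : ‖w - v‖ < 1 := by simpa [dist_eq_norm] using hwv
      linarith [norm_sub_norm_le w v]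
    have hinc := hslope x hx.1 w hw1 0 (ρ / 2) (by simpa using hρ₁) (by positivity) (by linarith)
    rw [zero_smul, zero_vadd] at hinc
    obtain ⟨r, hr0, hrρ, j, hj⟩ := exists_kink (a := a) (f := fun r => τ (r • w +ᵥ x)) hl
      (by linarith) (by fun_prop) hρ (by simpa only [zero_smul, zero_vadd] using hinc)
    have hG : ∀ r : ℝ, |r| ≤ ρ → S (r • w +ᵥ x) + δ * (B (r • w +ᵥ x) - S (r • w +ᵥ x)) =
        S x + δ * h x * (B x - S x) := by
      intro r hr
      have h1 := hone x hx.2 w hw2 0 r (by simpa using hρ₂) (hr.trans_lt hρρ₂)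
      rw [zero_smul, zero_vadd] at h1
      have h2 := hconst r
      rwa [show h (r • w +ᵥ x) = 1 from h1, mul_one] at h2
    -- Then `‖s • w‖ ≤ l`, so `τ` changes by at most `l / 2` and `le_triangleWave` applies.
    set s := l / (‖v‖ + 1) with hs
    have hspos : 0 < s := by positivity
    have hsW : s * (‖v‖ + 1) = l := div_mul_cancel₀ _ hW.ne'
    have hsl : s ≤ l := div_le_self hl.le hW1
    have hswl : ‖s • w‖ ≤ l := by
      rw [norm_smul, Real.norm_eq_abs, abs_of_pos hspos, ← hsW]
      gcongr
    set y := r • w +ᵥ x with hy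
    have hplus : (r + s) • w +ᵥ x = s • w +ᵥ y := by rw [add_comm, add_smul, ← vadd_vadd]
    have hminus : (r - s) • w +ᵥ x = -(s • w) +ᵥ y := by
      rw [sub_eq_neg_add, add_smul, ← vadd_vadd, neg_smul]
    have h0 := hG r (by rw [abs_le]; constructor <;> linarith)
    have h1 := hG (r + s) (by rw [abs_le]; constructor <;> linarith)
    have h2 := hG (r - s) (by rw [abs_le]; constructor <;> linarith)
    rw [hplus] at h1
    rw [hminus] at h2
    have hBy : B y = 0 := by
      change triangleWave l (τ y) = 0
      rw [show τ y = l * j from hj, triangleWave_intCast_mul]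
    have hBplus : a * s ≤ B (s • w +ᵥ y) := by
      have h3 := hslope x hx.1 w hw1 r s (by rw [abs_lt]; constructor <;> linarith) hspos.le
        (by linarith)
      have h4 := hτ y (s • w)
      rw [show τ y = l * j from hj] at h4
      refine (h3.trans ?_).trans (le_triangleWave hl j (h4.trans (by linarith)))
      rw [← show τ y = l * j from hj]
      exact le_abs_self _
    have hBminus : a * s ≤ B (-(s • w) +ᵥ y) := by
      have h3 := hslope x hx.1 w hw1 (r - s) s (by rw [abs_lt]; constructor <;> linarith) hspos.le
        (by linarith)
      rw [hminus, vadd_neg_vadd] at h3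
      have h4 := hτ y (-(s • w))
      rw [norm_neg, show τ y = l * j from hj] at h4
      refine (h3.trans ?_).trans (le_triangleWave hl j (h4.trans (by linarith)))
      rw [← show τ y = l * j from hj, abs_sub_comm]
      exact le_abs_self _
    have hconv : 2 * S y - 2 * K * ‖s • w‖ ^ 2 ≤ S (s • w +ᵥ y) + S (-(s • w) +ᵥ y) :=
      supConvolution_semiconvex hK.le hF1 y (s • w)
    have hsq : K * ‖s • w‖ ^ 2 ≤ δ * a * s / 2 := by
      have h5 : ‖s • w‖ ^ 2 ≤ l * l := by
        rw [sq]
        gcongr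
      calc K * ‖s • w‖ ^ 2 ≤ K * (l * l) := by gcongr
        _ = K * (l * (s * (‖v‖ + 1))) := by rw [hsW]
        _ = l * (2 * (K * (‖v‖ + 1))) * s / 2 := by ring
        _ ≤ δ * a * s / 2 := by gcongr
    -- Constancy would make the second difference at `y` zero, yet it is at least `2δas - 2(1 -
    -- δ)K‖s • w‖² ≥ δas > 0`.
    have h6 := mul_le_mul_of_nonneg_left hBplus hδ.le
    have h7 := mul_le_mul_of_nonneg_left hBminus hδ.le
    have h8 := mul_le_mul_of_nonneg_left hconv (sub_nonneg.mpr hδ1)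
    have h9 : (1 - δ) * (K * ‖s • w‖ ^ 2) ≤ K * ‖s • w‖ ^ 2 :=
      mul_le_of_le_one_left (by positivity) (by linarith)
    have h10 : 0 < δ * (a * s) := by positivity
    rw [hBy] at h0
    nlinarith

end Perturbation

/-! ### The topology of `Lip₁(ℝⁿ, I)` -/

section LipOneTopology

variable {n : ℕ}

theorem vadd_apply (u t : Rn n) (φ : LipOne n) : (u +ᵥ φ) t = φ (t + u) := rfl

theorem abs_apply_sub_le (φ ψ : LipOne n) (m : ℕ+) {t : Rn n} (ht : ‖t‖ ≤ m) :
    |(φ t : ℝ) - ψ t| ≤ 2 ^ (m : ℕ) * dist φ ψ := by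
  have h1 := le_supOnBall φ ψ m t ht
  have h2 : ((2 : ℝ) ^ (m : ℕ))⁻¹ * supOnBall φ ψ m ≤ dist φ ψ := le_lipDist φ ψ m
  rw [inv_mul_le_iff₀ (by positivity)] at h2
  exact h1.trans h2

theorem dist_le_of_forall_abs_sub_le {φ ψ : LipOne n} {c : ℝ}
    (h : ∀ t, |(φ t : ℝ) - ψ t| ≤ c) : dist φ ψ ≤ c := by
  refine ciSup_le fun m => ?_
  have h1 : supOnBall φ ψ m ≤ c := supOnBall_le φ ψ m fun t _ => h t
  have h2 : ((2 : ℝ) ^ (m : ℕ))⁻¹ ≤ 1 := inv_le_one_of_one_le₀ (one_le_pow₀ (by norm_num))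
  exact (mul_le_of_le_one_left (supOnBall_nonneg φ ψ m) h2).trans h1

theorem continuous_lipOne_apply :
    Continuous fun q : LipOne n × Rn n => ((q.1 q.2 : unitInterval) : ℝ) := by
  refine continuous_iff_continuousAt.mpr fun ⟨φ, t⟩ => ?_
  obtain ⟨m, hm⟩ := exists_nat_ge ‖t‖
  have ht : ‖t‖ ≤ (m.succPNat : ℕ) := by
    rw [Nat.succPNat_coe]
    push_cast
    linarith
  rw [ContinuousAt, tendsto_iff_dist_tendsto_zero]
  have hlim : Filter.Tendsto (fun q : LipOne n × Rn n => ‖q.2 - t‖ +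
      2 ^ (m.succPNat : ℕ) * dist q.1 φ) (𝓝 (φ, t)) (𝓝 0) := by
    have hc : Continuous fun q : LipOne n × Rn n => ‖q.2 - t‖ +
        2 ^ (m.succPNat : ℕ) * dist q.1 φ := by fun_prop
    simpa using hc.tendsto (φ, t)
  refine squeeze_zero (fun _ => dist_nonneg) (fun q => ?_) hlim
  rw [Real.dist_eq]
  exact (abs_sub_le _ (q.1 t : ℝ) _).trans
    (add_le_add (q.1.lipschitz _ _) (abs_apply_sub_le _ _ _ ht))

/-- Compactness gives uniform control on a ball of radius `M`; for larger balls the weight `2⁻ᵐ`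
suffices, since differences are at most `1`. -/
theorem continuous_lipOne_of_continuous_apply {X : Type*} [TopologicalSpace X] {g : X → LipOne n}
    (hg : Continuous fun q : X × Rn n => ((g q.1 q.2 : unitInterval) : ℝ)) : Continuous g := by
  refine continuous_iff_continuousAt.mpr fun x => Metric.tendsto_nhds.mpr fun ε hε => ?_
  obtain ⟨M, hM⟩ := exists_pow_lt_of_lt_one (half_pos hε) (by norm_num : (2⁻¹ : ℝ) < 1)
  have hcont : Continuous fun q : X × Rn n => |(g q.1 q.2 : ℝ) - g x q.2| := by
    have : Continuous fun q : X × Rn n => ((g x q.2 : unitInterval) : ℝ) :=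
      hg.comp (continuous_const.prodMk continuous_snd)
    exact (hg.sub this).abs
  have hev : ∀ᶠ y in 𝓝 x, ∀ t ∈ Metric.closedBall (0 : Rn n) M,
      |(g y t : ℝ) - g x t| < ε / 2 := by
    refine (isCompact_closedBall (0 : Rn n) (M : ℝ)).eventually_forall_of_forall_eventually
      fun t _ => hcont.continuousAt.eventually (gt_mem_nhds ?_)
    simpa using hε
  filter_upwards [hev] with y hy
  refine lt_of_le_of_lt (b := ε / 2) (ciSup_le fun m => ?_) (half_lt_self hε)
  have h2 : ((2 : ℝ) ^ (m : ℕ))⁻¹ ≤ 1 := inv_le_one_of_one_le₀ (one_le_pow₀ (by norm_num))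
  rcases le_total (m : ℕ) M with hmM | hmM
  · have h1 : supOnBall (g y) (g x) m ≤ ε / 2 := supOnBall_le _ _ m fun t ht =>
      (hy t (mem_closedBall_zero_iff.mpr (ht.trans (by exact_mod_cast hmM)))).le
    exact (mul_le_of_le_one_left (supOnBall_nonneg _ _ m) h2).trans h1
  · have h1 : supOnBall (g y) (g x) m ≤ 1 := supOnBall_le _ _ m fun t _ => abs_sub_le_one _ _ t
    calc ((2 : ℝ) ^ (m : ℕ))⁻¹ * supOnBall (g y) (g x) m ≤ ((2 : ℝ) ^ (m : ℕ))⁻¹ * 1 := by gcongr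
      _ = (2⁻¹ : ℝ) ^ (m : ℕ) := by rw [mul_one, inv_pow]
      _ ≤ (2⁻¹ : ℝ) ^ M := pow_le_pow_of_le_one (by norm_num) (by norm_num) hmM
      _ ≤ ε / 2 := hM.le

theorem isClosed_setOf_translate_eq {Z : Type*} [TopologicalSpace Z] {φ : Z → LipOne n}
    {u : Z → Rn n} (hφ : Continuous φ) (hu : Continuous u) :
    IsClosed {z | ∀ t, φ z (t + u z) = φ z t} := by
  rw [Set.ofPred_forall]
  refine isClosed_iInter fun t => ?_
  simp only [Subtype.ext_iff]
  exact isClosed_eq (continuous_lipOne_apply.comp (hφ.prodMk (by fun_prop)))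
    (continuous_lipOne_apply.comp (hφ.prodMk continuous_const))

end LipOneTopology

/-! ### Closedness of the strata -/

section Strata

variable {n : ℕ}

theorem isCompact_setOf_orthonormal (E : Type*) [NormedAddCommGroup E] [InnerProductSpace ℝ E]
    [ProperSpace E] (k : ℕ) : IsCompact {f : Fin k → E | Orthonormal ℝ f} := by
  refine (isCompact_univ_pi fun _ : Fin k => isCompact_closedBall (0 : E) 1).of_isClosed_subset
    ?_ fun f hf i _ => by simpa using (hf.1 i).le
  simp only [orthonormal_iff_ite, Set.ofPred_forall]
  exact isClosed_iInter fun i => isClosed_iInter fun j =>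
    isClosed_eq (by fun_prop) continuous_const

/-- A subspace of dimension at least `k` contains the span of an orthonormal `k`-frame. The frames
form a compact space, along which projection is a closed map. -/
theorem isClosed_setOf_exists_submodule {E Z : Type*} [NormedAddCommGroup E]
    [InnerProductSpace ℝ E] [FiniteDimensional ℝ E] [TopologicalSpace Z] (k : ℕ) {R : E → Z → Prop}
    (hR : IsClosed {q : E × Z | R q.1 q.2}) :
    IsClosed {z | ∃ W : Submodule ℝ E, k ≤ Module.finrank ℝ W ∧ ∀ u ∈ W, R u z} := by
  have : ProperSpace E := FiniteDimensional.proper ℝ E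
  have := isCompact_iff_compactSpace.mp (isCompact_setOf_orthonormal E k)
  have hC : IsClosed {q : {f : Fin k → E | Orthonormal ℝ f} × Z |
      ∀ c : Fin k → ℝ, R (∑ i, c i • q.1.1 i) q.2} := by
    rw [Set.ofPred_forall]
    have hsum (c : Fin k → ℝ) : Continuous fun q : {f : Fin k → E | Orthonormal ℝ f} × Z =>
        ∑ i, c i • q.1.1 i :=
      continuous_finsetSum _ fun i _ => continuous_const.smul
        ((continuous_apply i).comp (continuous_subtype_val.comp continuous_fst))
    exact isClosed_iInter fun c => hR.preimage ((hsum c).prodMk continuous_snd)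
  convert isClosedMap_snd_of_compactSpace _ hC using 1
  ext z
  constructor
  · rintro ⟨W, hk, hW⟩
    refine ⟨(⟨fun i => (stdOrthonormalBasis ℝ W (Fin.castLE hk i) : E), ?_⟩, z),
      fun c => hW _ ?_, rfl⟩
    · exact ((stdOrthonormalBasis ℝ W).orthonormal.comp_linearIsometry W.subtypeₗᵢ).comp _
        (Fin.castLE_injective hk)
    · exact W.sum_mem fun i _ => W.smul_mem _ (Subtype.mem _)
  · rintro ⟨⟨⟨f, hf⟩, z'⟩, hR', rfl⟩
    refine ⟨Submodule.span ℝ (Set.range f), ?_, fun u hu => ?_⟩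
    · rw [finrank_span_eq_card hf.linearIndependent, Fintype.card_fin]
    · obtain ⟨c, rfl⟩ := (Submodule.mem_span_range_iff_exists_fun ℝ).mp hu
      exact hR' c

theorem isClosed_invariantFunctions (n k : ℕ) : IsClosed (invariantFunctions n k) := by
  have h := isClosed_setOf_exists_submodule k
    (R := fun (u : Rn n) (φ : LipOne n) => ∀ t, φ (t + u) = φ t)
    (isClosed_setOf_translate_eq (Z := Rn n × LipOne n) continuous_snd continuous_fst)
  convert h using 1
  ext φ
  exact exists_congr fun W => and_congr_right fun _ =>
    ⟨fun h u hu t => h t u hu, fun h t u hu => h u hu t⟩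

variable {X : Type*} [AddAction (Rn n) X]

theorem mem_stratum_iff {k : ℕ} {x : X} : x ∈ stratum n X k ↔
    ∃ W : Submodule ℝ (Rn n), k ≤ Module.finrank ℝ W ∧ ∀ u ∈ W, u +ᵥ x = x :=
  ⟨fun h => ⟨_, h, (isGreatest_stabSubspace n x).1⟩, fun ⟨_, hk, hW⟩ =>
    hk.trans (Submodule.finrank_mono ((isGreatest_stabSubspace n x).2 hW))⟩

theorem isClosed_stratum [TopologicalSpace X] [T2Space X] [ContinuousVAdd (Rn n) X] (k : ℕ) :
    IsClosed (stratum n X k) := by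
  have h := isClosed_setOf_exists_submodule k (R := fun (u : Rn n) (x : X) => u +ᵥ x = x)
    (isClosed_eq (by fun_prop) (by fun_prop))
  convert h using 1
  ext x
  exact mem_stratum_iff

theorem vadd_eq_of_mem_stratum_self {x : X} (hx : x ∈ stratum n X n) (t : Rn n) : t +ᵥ x = x := by
  have h1 : stabSubspace n x = ⊤ := Submodule.eq_top_of_finrank_eq
    (le_antisymm (Submodule.finrank_le _) (finrank_euclideanSpace_fin.trans_le hx))
  exact (isGreatest_stabSubspace n x).1 t (h1 ▸ Submodule.mem_top)

end Strata

/-! ### Density for a single direction -/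

section Density

variable {n : ℕ} {X : Type*} [TopologicalSpace X] [AddAction (Rn n) X]

/-- The functions that are constant along the lines in some direction `w ∈ N`. -/
def lineInvariant (N : Set (Rn n)) : Set (LipOne n) :=
  {φ | ∃ w ∈ N, ∀ (s : ℝ) (t : Rn n), φ (t + s • w) = φ t}

theorem isClosed_lineInvariant {N : Set (Rn n)} (hN : IsCompact N) :
    IsClosed (lineInvariant N) := by
  have := isCompact_iff_compactSpace.mp hN
  have hC : IsClosed {q : N × LipOne n | ∀ (s : ℝ) (t : Rn n), q.2 (t + s • q.1.1) = q.2 t} := by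
    rw [Set.ofPred_forall]
    exact isClosed_iInter fun s => isClosed_setOf_translate_eq continuous_snd (by fun_prop)
  convert isClosedMap_snd_of_compactSpace _ hC using 1
  ext φ
  constructor
  · rintro ⟨w, hw, h⟩
    exact ⟨(⟨w, hw⟩, φ), h, rfl⟩
  · rintro ⟨⟨w, φ'⟩, h, rfl⟩
    exact ⟨w, w.2, h⟩

/-- The orbit map `x ↦ (t ↦ G (t + x))` of a function that is one-Lipschitz along orbits. -/
def orbitMap [ContinuousVAdd (Rn n) X] (G : X → ℝ) (hG : Continuous G) (hG0 : ∀ x, 0 ≤ G x)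
    (hG1 : ∀ x, G x ≤ 1) (hlip : ∀ x, ∀ t : Rn n, |G (t +ᵥ x) - G x| ≤ ‖t‖) :
    C(X, LipOne n) where
  toFun x := ⟨fun t => ⟨G (t +ᵥ x), hG0 _, hG1 _⟩, fun t u => by
    simpa [vadd_vadd] using hlip (u +ᵥ x) (t - u)⟩
  continuous_toFun := continuous_lipOne_of_continuous_apply (by
    change Continuous fun q : X × Rn n => G (q.2 +ᵥ q.1)
    fun_prop)

variable {ι : stratum n X n → invariantFunctions n n}

theorem isOpen_setOf_equivariantMaps_mapsTo {K : Set X} {O : Set (LipOne n)} (hK : IsCompact K)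
    (hO : IsOpen O) : IsOpen {f : equivariantMaps ι | Set.MapsTo (f : C(X, LipOne n)) K O} :=
  (ContinuousMap.isOpen_setOfPred_mapsTo hK hO).preimage continuous_subtype_val

theorem apply_vadd_zero (f : equivariantMaps ι) (t : Rn n) (x : X) :
    (f : C(X, LipOne n)) (t +ᵥ x) 0 = (f : C(X, LipOne n)) x t := by
  rw [f.2.1, vadd_apply, zero_add]

/-- Perturb `x ↦ f x 0` and return to an equivariant map through orbits; agreement at fixed points
preserves the condition `f = ι`. -/
theorem exists_dense_avoiding [CompactSpace X] [TopologicalSpace.MetrizableSpace X]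
    [ContinuousVAdd (Rn n) X] (ι : stratum n X n → invariantFunctions n n) {p : X} {v : Rn n} (hv : v +ᵥ p ≠ p) :
    ∃ U ∈ 𝓝 p, IsClosed U ∧ ∃ N ∈ 𝓝 v, IsCompact N ∧
      Dense {f : equivariantMaps ι |
        Set.MapsTo (f : C(X, LipOne n)) U (lineInvariant N)ᶜ} := by
  let _ := TopologicalSpace.metrizableSpaceMetric X
  obtain ⟨U₀, hU₀, N₀, hN₀, hpert⟩ := exists_perturbation hv
  obtain ⟨U, hU, hUc, hUU₀⟩ := exists_mem_nhds_isClosed_subset hU₀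
  obtain ⟨N, hN, hNN₀, hNc⟩ := local_compact_nhds hN₀
  refine ⟨U, hU, hUc, N, hN, hNc, Metric.dense_iff.mpr fun f ε hε => ?_⟩
  have hFlip : ∀ x, ∀ t : Rn n, |(((f : C(X, LipOne n)) (t +ᵥ x) 0 : unitInterval) : ℝ) -
      (f : C(X, LipOne n)) x 0| ≤ ‖t‖ := fun x t => by
    rw [apply_vadd_zero]
    simpa using ((f : C(X, LipOne n)) x).lipschitz t 0
  obtain ⟨G, hGc, hG0, hG1, hGlip, hGfix, hGF, hG⟩ :=
    hpert (fun x => (f : C(X, LipOne n)) x 0)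
      (continuous_lipOne_apply.comp (f.1.continuous.prodMk continuous_const))
      (fun x => ((f : C(X, LipOne n)) x 0).2.1) (fun x => ((f : C(X, LipOne n)) x 0).2.2)
      hFlip (ε / 2) (half_pos hε)
  have hmem : orbitMap G hGc hG0 hG1 hGlip ∈ equivariantMaps ι := by
    refine ⟨fun t x => ?_, fun x => ?_⟩
    · ext s
      change G (s +ᵥ (t +ᵥ x)) = G ((s + t) +ᵥ x)
      rw [add_vadd]
    · have hx := vadd_eq_of_mem_stratum_self x.2
      rw [← f.2.2 x]
      ext s
      change G (s +ᵥ (x : X)) = _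
      rw [hGfix _ (fun t => by rw [hx s, hx t]), apply_vadd_zero]
  refine ⟨⟨_, hmem⟩, ?_, fun x hx => ?_⟩
  · rw [Metric.mem_ball, Subtype.dist_eq]
    refine lt_of_le_of_lt ((ContinuousMap.dist_le (half_pos hε).le).mpr fun x => ?_)
      (half_lt_self hε)
    refine dist_le_of_forall_abs_sub_le fun t => ?_
    rw [← apply_vadd_zero f]
    exact hGF (t +ᵥ x)
  · rintro ⟨w, hw, hconst⟩
    obtain ⟨s, hs⟩ := hG x (hUU₀ hx) w (hNN₀ hw)
    have h1 := congrArg Subtype.val (hconst s 0)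
    change G ((0 + s • w) +ᵥ x) = G ((0 : Rn n) +ᵥ x) at h1
    rw [zero_add, zero_vadd] at h1
    exact hs h1

theorem dense_biInter_finset_of_isOpen {α β : Type*} [TopologicalSpace α] (s : Finset β)
    {D : β → Set α} (ho : ∀ i ∈ s, IsOpen (D i)) (hd : ∀ i ∈ s, Dense (D i)) :
    Dense (⋂ i ∈ s, D i) := by
  classical
  induction s using Finset.induction_on with
  | empty => simp
  | insert i s _ ih =>
    rw [Finset.set_biInter_insert]
    exact (hd i (Finset.mem_insert_self i s)).inter_of_isOpen_left
      (ih (fun j hj => ho j (Finset.mem_insert_of_mem hj))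
        fun j hj => hd j (Finset.mem_insert_of_mem hj)) (ho i (Finset.mem_insert_self i s))

end Density

/-! ### Directions transverse to the stabilizer -/

section Directions

variable {n : ℕ}

theorem exists_unit_mem_inf_orthogonal {k : ℕ} {V W : Submodule ℝ (Rn n)}
    (hV : Module.finrank ℝ V ≤ k) (hW : k + 1 ≤ Module.finrank ℝ W) :
    ∃ w ∈ W, w ∈ Vᗮ ∧ ‖w‖ = 1 := by
  have hne : W ⊓ Vᗮ ≠ ⊥ := by
    intro h
    have h1 := Submodule.finrank_add_finrank_le_of_disjoint (disjoint_iff.mpr h)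
    have h2 := Submodule.finrank_add_finrank_orthogonal V
    omega
  obtain ⟨w, hw, hw0⟩ := Submodule.exists_mem_ne_zero_of_ne_bot hne
  refine ⟨‖w‖⁻¹ • w, W.smul_mem _ hw.1, Vᗮ.smul_mem _ hw.2, ?_⟩
  rw [norm_smul, norm_inv, norm_norm, inv_mul_cancel₀ (norm_ne_zero_iff.mpr hw0)]

/-- Otherwise the line through `w` would lie in `𝔤_p` by maximality, making `w` orthogonal to
itself. -/
theorem exists_smul_vadd_ne {X : Type*} [AddAction (Rn n) X] {p : X} {w : Rn n}
    (hw : w ∈ (stabSubspace n p)ᗮ) (hw0 : w ≠ 0) : ∃ c : ℝ, c • w +ᵥ p ≠ p := by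
  by_contra! h
  have h1 : Submodule.span ℝ {w} ≤ stabSubspace n p :=
    (isGreatest_stabSubspace n p).2 fun t ht => by
      obtain ⟨c, rfl⟩ := Submodule.mem_span_singleton.mp ht
      exact h c
  have h2 := Submodule.inner_right_of_mem_orthogonal (h1 (Submodule.mem_span_singleton_self w)) hw
  exact hw0 (inner_self_eq_zero.mp h2)

end Directions

end LipEmbedding

/-! ### Assembly by compactness of the sphere of directions -/

theorem mainTheorem2 {n : ℕ} {X : Type*} [TopologicalSpace X] [CompactSpace X]
    [TopologicalSpace.MetrizableSpace X] [AddAction (LipEmbedding.Rn n) X]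
    [ContinuousVAdd (LipEmbedding.Rn n) X]
    (ι : LipEmbedding.stratum n X n → LipEmbedding.invariantFunctions n n)
    (hι : IsEmbedding ι) (k : ℕ) (hk : k < n)
    (p : LipEmbedding.stratum n X k) (hp : (p : X) ∉ LipEmbedding.stratum n X (k + 1)) :
    ∃ A : Set (LipEmbedding.stratum n X k),
      IsClosed A ∧ A ∈ 𝓝 p ∧
      Subtype.val '' A ∩ LipEmbedding.stratum n X (k + 1) = ∅ ∧
      IsOpen (LipEmbedding.avoidingMaps ι k (Subtype.val '' A)) ∧
      Dense (LipEmbedding.avoidingMaps ι k (Subtype.val '' A)) := by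
  open LipEmbedding in
  have hdim : Module.finrank ℝ (stabSubspace n (p : X)) ≤ k := Nat.lt_succ_iff.mp (not_le.mp hp)
  set S : Set (Rn n) := {w | w ∈ (stabSubspace n (p : X))ᗮ ∧ ‖w‖ = 1} with hS
  have hSc : IsCompact S := by
    have : S = Metric.sphere 0 1 ∩ ((stabSubspace n (p : X))ᗮ : Set (Rn n)) := by
      ext w
      simp [hS, and_comm]
    rw [this]
    exact (isCompact_sphere 0 1).inter_right (Submodule.isClosed_orthogonal _)
  have hex : ∀ w ∈ S, ∃ c : ℝ, ∃ U ∈ 𝓝 (p : X), IsClosed U ∧ ∃ N ∈ 𝓝 (c • w), IsCompact N ∧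
      Dense {f : equivariantMaps ι |
        Set.MapsTo (f : C(X, LipOne n)) U (lineInvariant N)ᶜ} := fun w hw => by
    obtain ⟨c, hc⟩ := exists_smul_vadd_ne hw.1 (norm_ne_zero_iff.mp (by rw [hw.2]; norm_num))
    exact ⟨c, exists_dense_avoiding ι hc⟩
  choose! c U hU hUc N hN hNc hD using hex
  -- `N w` surrounds `c w • w` rather than `w`, so it is pulled back by the scaling; invariance
  -- under a subspace passes to multiples.
  obtain ⟨F, hFS, hcover⟩ := hSc.elim_nhds_subcover (fun w => (fun u => c w • u) ⁻¹' N w)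
    fun w hw => (continuous_const_smul (c w)).continuousAt.preimage_mem_nhds (hN w hw)
  obtain ⟨O, hO, hOc, hOsub⟩ := exists_mem_nhds_isClosed_subset
    ((isClosed_stratum (n := n) (X := X) (k + 1)).isOpen_compl.mem_nhds hp)
  have hBc : IsClosed (O ∩ ⋂ w ∈ F, U w) :=
    hOc.inter (isClosed_biInter fun w hw => hUc w (hFS w hw))
  have hAc : IsClosed (Subtype.val '' (Subtype.val ⁻¹' (O ∩ ⋂ w ∈ F, U w) : Set (stratum n X k))) :=
    (isClosed_stratum k).isClosedEmbedding_subtypeVal.isClosedMap _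
      (hBc.preimage continuous_subtype_val)
  refine ⟨Subtype.val ⁻¹' (O ∩ ⋂ w ∈ F, U w), hBc.preimage continuous_subtype_val,
    continuous_subtype_val.continuousAt.preimage_mem_nhds (Filter.inter_mem hO
      ((Filter.biInter_finset_mem F).mpr fun w hw => hU w (hFS w hw))), ?_, ?_, ?_⟩
  · rw [Set.eq_empty_iff_forall_notMem]
    rintro _ ⟨⟨x, hx, rfl⟩, hx'⟩
    exact hOsub hx.1 hx'
  · convert isOpen_setOf_equivariantMaps_mapsTo (ι := ι) hAc.isCompact
      (isClosed_invariantFunctions n (k + 1)).isOpen_compl using 1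
    ext f
    rw [Set.mem_ofPred_eq, Set.mapsTo_iff_image_subset, Set.subset_compl_iff_disjoint_right,
      Set.disjoint_iff_inter_eq_empty]
    rfl
  · refine (dense_biInter_finset_of_isOpen F (fun w hw => isOpen_setOf_equivariantMaps_mapsTo
      (hUc w (hFS w hw)).isCompact (isClosed_lineInvariant (hNc w (hFS w hw))).isOpen_compl)
      fun w hw => hD w (hFS w hw)).mono fun f hf => ?_
    change _ = ∅
    rw [Set.eq_empty_iff_forall_notMem]
    rintro _ ⟨⟨_, ⟨x, hx, rfl⟩, rfl⟩, W, hW, hinv⟩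
    obtain ⟨u, huW, huV, hu1⟩ := exists_unit_mem_inf_orthogonal hdim hW
    obtain ⟨w, hwF, hwu⟩ := Set.mem_iUnion₂.mp (hcover ⟨huV, hu1⟩)
    have hxU : (x : X) ∈ U w := Set.mem_iInter₂.mp hx.2 w hwF
    exact Set.mem_iInter₂.mp hf w hwF hxU ⟨c w • u, hwu, fun s t =>
      hinv t _ (W.smul_mem _ (W.smul_mem _ huW))⟩
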